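/- Let $I=[0,1]$ and $S^1=\{z\in\mathbb{C}:|z|=1\}$. For $M=I$, $M=[0,1)$ or $M=S^1$, let $\mathrm{Diff}^2(M)$ denote the group, under composition, of all orientation-preserving $C^2$ diffeomorphisms of $M$, that is, of all orientation-preserving bijections $f:M\to M$ such that $f$ and $f^{-1}$ are both of class $C^2$ (with one-sided derivatives at the endpoints belonging to $M$ when $M$ is an interval). **Theorem.** Every nilpotent subgroup of $\mathrm{Diff}^2(I)$, of $\mathrm{Diff}^2([0,1))$ or of $\mathrm{Diff}^2(S^1)$ is abelian. -/

import Mathlib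

open scoped Manifold ContDiff

/-- A self-map `f` of a set `J ⊆ ℝ` (in practice an interval) is of class `C²`, with one-sided
derivatives at the endpoints that belong to `J`. -/
def IsCTwoOn (J : Set ℝ) (f : J → J) : Prop :=
  ∃ F : ℝ → ℝ, ContDiffOn ℝ 2 F J ∧ ∀ x : J, F x = f x

theorem IsCTwoOn.id (J : Set ℝ) : IsCTwoOn J (fun x => x) :=
  ⟨fun x => x, contDiffOn_id, fun _ => rfl⟩

theorem IsCTwoOn.comp {J : Set ℝ} {f g : J → J} (hf : IsCTwoOn J f) (hg : IsCTwoOn J g) :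
    IsCTwoOn J (fun x => f (g x)) := by
  obtain ⟨F, hF, hFf⟩ := hf
  obtain ⟨G, hG, hGg⟩ := hg
  refine ⟨F ∘ G, hF.comp hG ?_, fun x => ?_⟩
  · intro x hx
    rw [hGg ⟨x, hx⟩]
    exact (g ⟨x, hx⟩).2
  · rw [Function.comp_apply, hGg, hFf]

/-- `Diff²(J)` for an interval `J ⊆ ℝ`: the group, under composition, of the
orientation-preserving (that is, strictly increasing) bijections `f : J → J`
such that `f` and its inverse are both of class `C²`. -/
def diffTwoInterval (J : Set ℝ) : Subgroup (Equiv.Perm J) where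
  carrier := {f | IsCTwoOn J f ∧ IsCTwoOn J f.symm ∧ StrictMono f}
  mul_mem' := by
    rintro f g ⟨hf, hf', hfm⟩ ⟨hg, hg', hgm⟩
    exact ⟨hf.comp hg, hg'.comp hf', hfm.comp hgm⟩
  one_mem' := ⟨IsCTwoOn.id J, IsCTwoOn.id J, strictMono_id⟩
  inv_mem' := by
    rintro f ⟨hf, hf', hfm⟩
    refine ⟨hf', hf, fun x y hxy => ?_⟩
    refine hfm.lt_iff_lt.mp ?_
    simpa using hxy

/-- A bijection of the unit circle is an orientation-preserving homeomorphism when it lifts,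
through the covering `t ↦ exp (i t)`, to an increasing homeomorphism (equivalently, an order
isomorphism) of the real line. -/
def IsOrientationPreserving (f : Equiv.Perm Circle) : Prop :=
  ∃ F : ℝ ≃o ℝ, ∀ t : ℝ, f (Circle.exp t) = Circle.exp (F t)

/-- `Diff²(S¹)`: the group, under composition, of the orientation-preserving bijections `f` of
the unit circle such that `f` and its inverse are both of class `C²` for the standard manifold
structure of the circle. -/
def diffTwoCircle : Subgroup (Equiv.Perm Circle) where
  carrier := {f | ContMDiff (𝓡 1) (𝓡 1) 2 f ∧ ContMDiff (𝓡 1) (𝓡 1) 2 f.symm ∧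
    IsOrientationPreserving f}
  mul_mem' := by
    rintro f g ⟨hf, hf', F, hF⟩ ⟨hg, hg', G, hG⟩
    refine ⟨hf.comp hg, hg'.comp hf', G.trans F, fun t => ?_⟩
    rw [Equiv.Perm.mul_apply, hG, hF, OrderIso.trans_apply]
  one_mem' := ⟨contMDiff_id, contMDiff_id, OrderIso.refl ℝ, fun _ => rfl⟩
  inv_mem' := by
    rintro f ⟨hf, hf', F, hF⟩
    refine ⟨hf', hf, F.symm, fun t => ?_⟩
    rw [Equiv.Perm.inv_eq_iff_eq, hF, OrderIso.apply_symm_apply]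

/-! A nonabelian nilpotent group contains f, g whose commutator K = fgf⁻¹g⁻¹ is nontrivial and
commutes with both; such a K is excluded. The tool is Kopell's lemma, where C² enters only through
log h' being Lipschitz. If the intervals F^i(a,b) have finite total length and K commutes with F and
fixes a and b, then K is the identity on (a,b): the distortion of F^n there is bounded uniformly in
n, and conjugation by F^n moves K^m to tiny intervals where its derivative is near 1. So all powers
of K contract at most by one common factor, which is impossible for the disjoint intervals between
successive points of a K-orbit.

If K ≠ 1, let (a,b) be a component of the complement of Fix K; maps commuting with K permute these
components. On the interval, a moved component would wander, against Kopell, so f and g fix a and b.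
On the circle one lifts to the line: translation numbers show that K has a fixed point, and finite
length of the circle makes powers of f and g, up to integer translations, fix a and b.

Inside (a,b), say K < id. For large n, h = K⁻ⁿg moves some x up, hence by Kopell moves every point
up. But f^m h f^{-m} = K^m h, which for large m does not move x up. -/

theorem Group.IsNilpotent.mul_comm_of_central_commutator {G : Type*} [Group G]
    (hG : Group.IsNilpotent G)
    (h : ∀ f g k : G, f * g = k * g * f → Commute f k → Commute g k → k = 1) (f g : G) :
    f * g = g * f := by
  have key : ∀ n, Subgroup.upperCentralSeries G n ≤ Subgroup.center G := by
    intro n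
    induction n with
    | zero => simp
    | succ n ih =>
      intro x hx
      rw [Subgroup.mem_center_iff]
      intro y
      have hc := Subgroup.mem_center_iff.mp (ih (Subgroup.mem_upperCentralSeries_succ_iff.mp hx y))
      refine (commutatorElement_eq_one_iff_mul_comm.mp (h x y _ ?_ (hc x) (hc y))).symm
      rw [commutatorElement_def]
      group
  obtain ⟨n, hn⟩ := hG.nilpotent'
  have hf : f ∈ Subgroup.center G := key n (hn ▸ Subgroup.mem_top f)
  exact (Subgroup.mem_center_iff.mp hf g).symm

/-! ### Bounded distortion and Kopell's lemma -/

/-- `h` has positive derivative on `U`, and the logarithm of its derivative is Lipschitz there. -/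
def LogLipOn (h : ℝ → ℝ) (U : Set ℝ) : Prop :=
  (∀ x ∈ U, DifferentiableAt ℝ h x ∧ 0 < deriv h x) ∧
    ∃ C : NNReal, LipschitzOnWith C (fun x => Real.log (deriv h x)) U

theorem LogLipOn.mono {h : ℝ → ℝ} {U V : Set ℝ} (hh : LogLipOn h V) (hUV : U ⊆ V) :
    LogLipOn h U :=
  ⟨fun x hx => hh.1 x (hUV hx), hh.2.imp fun _ hC => hC.mono hUV⟩

theorem StrictMono.perm_inv {f : Equiv.Perm ℝ} (hf : StrictMono f) : StrictMono ⇑f⁻¹ := by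
  intro x y hxy
  refine hf.lt_iff_lt.mp ?_
  simpa using hxy

theorem StrictMono.perm_mul {f g : Equiv.Perm ℝ} (hf : StrictMono f) (hg : StrictMono g) :
    StrictMono ⇑(f * g) := fun _ _ hxy => hf (hg hxy)

theorem StrictMono.perm_pow {f : Equiv.Perm ℝ} (hf : StrictMono f) (n : ℕ) :
    StrictMono ⇑(f ^ n) := by
  induction n with
  | zero => exact fun x y h => h
  | succ n ih => exact pow_succ f n ▸ ih.perm_mul hf

theorem StrictMono.perm_continuous {f : Equiv.Perm ℝ} (hf : StrictMono f) : Continuous f :=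
  hf.monotone.continuous_of_surjective f.surjective

theorem Equiv.Perm.pow_apply_of_apply_eq {α : Type*} {f : Equiv.Perm α} {x : α} (h : f x = x)
    (n : ℕ) : (f ^ n) x = x := by
  induction n with
  | zero => rfl
  | succ n ih => rw [pow_succ, Equiv.Perm.mul_apply, h, ih]

theorem Commute.perm_apply {α : Type*} {f g : Equiv.Perm α} (h : Commute f g) (x : α) :
    f (g x) = g (f x) := DFunLike.congr_fun h.eq x

theorem Commute.perm_apply_fixed {α : Type*} {f g : Equiv.Perm α} (h : Commute f g) {x : α}
    (hx : g x = x) : g (f x) = f x := by rw [← h.perm_apply, hx]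

/-- The chain rule for the iterates of a map, with the derivative in exponential form. -/
theorem hasDerivAt_pow_of_logLipOn {F : Equiv.Perm ℝ} {U : Set ℝ} (hFU : LogLipOn F U) {z : ℝ}
    (hz : ∀ i : ℕ, (F ^ i) z ∈ U) (n : ℕ) :
    HasDerivAt ⇑(F ^ n)
      (Real.exp (∑ i ∈ Finset.range n, Real.log (deriv F ((F ^ i) z)))) z := by
  induction n with
  | zero => simpa using hasDerivAt_id z
  | succ n ih =>
    obtain ⟨hd, hpos⟩ := hFU.1 _ (hz n)
    rw [Finset.sum_range_succ, Real.exp_add, Real.exp_log hpos, mul_comm, pow_succ']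
    exact hd.hasDerivAt.comp z ih

/-- Bounded distortion: a map `H` commuting with `F` and fixing the endpoints of an interval whose
forward iterates under `F` have finite total length cannot contract that interval by more than a
factor which depends only on `F`. -/
theorem sub_le_sub_of_wandering {F H : Equiv.Perm ℝ} (hF : StrictMono F) (hH : StrictMono H)
    (hFH : Commute F H) {a b : ℝ} (ha : H a = a) (hb : H b = b) {U : Set ℝ}
    (hU : ∀ i : ℕ, Set.Ioo ((F ^ i) a) ((F ^ i) b) ⊆ U) (hFU : LogLipOn F U) (hHU : LogLipOn H U)
    {C : NNReal} (hC : LipschitzOnWith C (fun x => Real.log (deriv F x)) U) {L : ℝ}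
    (hL : ∀ n : ℕ, ∑ i ∈ Finset.range n, ((F ^ i) b - (F ^ i) a) ≤ L)
    {x y : ℝ} (hax : a < x) (hxy : x < y) (hyb : y < b) :
    Real.exp (-(C * L)) * (y - x) ≤ H y - H x := by
  obtain ⟨D, hD⟩ := hHU.2
  have hab : a < b := hax.trans (hxy.trans hyb)
  have hlen : ∀ n : ℕ, 0 ≤ (F ^ n) b - (F ^ n) a := fun n =>
    sub_nonneg.mpr ((hF.perm_pow n) hab).le
  have hlim : Filter.Tendsto (fun n : ℕ => (F ^ n) b - (F ^ n) a) Filter.atTop (nhds 0) :=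
    (summable_of_sum_range_le hlen hL).tendsto_atTop_zero
  have hmem : ∀ z ∈ Set.Ioo a b, ∀ i : ℕ, (F ^ i) z ∈ U := fun z hz i =>
    hU i ⟨hF.perm_pow i hz.1, hF.perm_pow i hz.2⟩
  -- Write H = F⁻ⁿ H Fⁿ on (a,b): the factor with C bounds the distortion of Fⁿ, the factor with D
  -- the derivative of H on the short interval Fⁿ(a,b).
  have key : ∀ n : ℕ, Real.exp (-(C * L)) * Real.exp (-(D * ((F ^ n) b - (F ^ n) a))) * (y - x) ≤
      H y - H x := by
    intro n
    set S : ℝ → ℝ := fun z => ∑ i ∈ Finset.range n, Real.log (deriv F ((F ^ i) z)) with hS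
    have hSder : ∀ z ∈ Set.Ioo a b, HasDerivAt ⇑(F ^ n) (Real.exp (S z)) z := fun z hz =>
      hasDerivAt_pow_of_logLipOn hFU (hmem z hz) n
    have hSdist : ∀ z ∈ Set.Ioo a b, ∀ w ∈ Set.Ioo a b, S z - S w ≤ C * L := by
      intro z hz w hw
      calc S z - S w = ∑ i ∈ Finset.range n,
            (Real.log (deriv F ((F ^ i) z)) - Real.log (deriv F ((F ^ i) w))) := by
            rw [Finset.sum_sub_distrib]
        _ ≤ ∑ i ∈ Finset.range n, C * ((F ^ i) b - (F ^ i) a) := by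
            refine Finset.sum_le_sum fun i _ => ?_
            refine (le_abs_self _).trans ((hC.dist_le_mul _ (hmem z hz i) _ (hmem w hw i)).trans ?_)
            refine mul_le_mul_of_nonneg_left ?_ C.2
            rw [Real.dist_eq, abs_sub_le_iff]
            have h1 := hF.perm_pow i hz.1
            have h2 := hF.perm_pow i hz.2
            have h3 := hF.perm_pow i hw.1
            have h4 := hF.perm_pow i hw.2
            constructor <;> linarith
        _ ≤ C * L := by
            rw [← Finset.mul_sum]
            exact mul_le_mul_of_nonneg_left (hL n) C.2
    have hcomm : Commute (F ^ n) H := hFH.pow_left n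
    have hmvtF : ∀ u v, a < u → u < v → v < b →
        ∃ w ∈ Set.Ioo a b, (F ^ n) v - (F ^ n) u = Real.exp (S w) * (v - u) := by
      intro u v hu huv hv
      obtain ⟨w, hw, hw'⟩ := exists_hasDerivAt_eq_slope ⇑(F ^ n) (fun z => Real.exp (S z)) huv
        (hF.perm_pow n).perm_continuous.continuousOn
        (fun z hz => hSder z ⟨hu.trans hz.1, hz.2.trans hv⟩)
      refine ⟨w, ⟨hu.trans hw.1, hw.2.trans hv⟩, ?_⟩
      rw [hw', div_mul_cancel₀ _ (sub_pos.mpr huv).ne']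
    have hmvtH : ∀ u v, (F ^ n) a ≤ u → u < v → v ≤ (F ^ n) b →
        ∃ w ∈ Set.Ioo ((F ^ n) a) ((F ^ n) b), H v - H u = deriv H w * (v - u) := by
      intro u v hu huv hv
      obtain ⟨w, hw, hw'⟩ := exists_deriv_eq_slope H huv hH.perm_continuous.continuousOn
        (fun z hz => (hHU.1 z (hU n ⟨hu.trans_lt hz.1,
          hz.2.trans_le hv⟩)).1.differentiableWithinAt)
      refine ⟨w, ⟨hu.trans_lt hw.1, hw.2.trans_le hv⟩, ?_⟩
      rw [hw', div_mul_cancel₀ _ (sub_pos.mpr huv).ne']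
    have hFn := hF.perm_pow n
    -- H fixes both ends of Fⁿ(a,b), so its derivative is 1 at some η there, and close to 1 on the
    -- whole interval.
    obtain ⟨η, hη, hη1⟩ := hmvtH _ _ le_rfl (hFn hab) le_rfl
    rw [hcomm.perm_apply_fixed ha, hcomm.perm_apply_fixed hb,
      right_eq_mul₀ (sub_pos.mpr (hFn hab)).ne'] at hη1
    obtain ⟨ξ, hξ, hξ1⟩ := hmvtH _ _ (hFn hax).le (hFn hxy) (hFn hyb).le
    have hξlog : -(D * ((F ^ n) b - (F ^ n) a)) ≤ Real.log (deriv H ξ) := by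
      have h1 := hD.dist_le_mul _ (hU n hξ) _ (hU n hη)
      simp only [hη1, Real.log_one, Real.dist_eq, sub_zero] at h1
      have h2 : |ξ - η| ≤ (F ^ n) b - (F ^ n) a := by
        rw [abs_sub_le_iff]
        constructor <;> linarith [hξ.1, hξ.2, hη.1, hη.2]
      have h3 := mul_le_mul_of_nonneg_left h2 D.2
      have h4 := neg_abs_le (Real.log (deriv H ξ))
      change (D : ℝ) * _ ≤ D * _ at h3
      linarith
    have hξexp := (Real.le_log_iff_exp_le (hHU.1 ξ (hU n hξ)).2).mp hξlog
    obtain ⟨w, hw, hw1⟩ := hmvtF x y hax hxy hyb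
    obtain ⟨z, hz, hz1⟩ := hmvtF (H x) (H y) (ha ▸ hH hax) (hH hxy) (hb ▸ hH hyb)
    rw [hcomm.perm_apply, hcomm.perm_apply, hξ1, hw1] at hz1
    have hξpos := (hHU.1 ξ (hU n hξ)).2
    have hsub : 0 < y - x := sub_pos.mpr hxy
    have hexp : Real.exp (-(C * L)) * Real.exp (S z) ≤ Real.exp (S w) := by
      rw [← Real.exp_add, Real.exp_le_exp]
      linarith [hSdist z hz w hw]
    refine le_of_mul_le_mul_left ?_ (Real.exp_pos (S z))
    rw [← hz1]
    calc Real.exp (S z) * (Real.exp (-(C * L)) * Real.exp (-(D * ((F ^ n) b - (F ^ n) a))) *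
          (y - x))
        = Real.exp (-(D * ((F ^ n) b - (F ^ n) a))) *
          ((Real.exp (-(C * L)) * Real.exp (S z)) * (y - x)) := by ring
      _ ≤ deriv H ξ * (Real.exp (S w) * (y - x)) := by gcongr
  -- As n → ∞ the constant D of H drops out, so the bound is the same for all powers of a map.
  have hlim2 : Filter.Tendsto (fun n : ℕ => Real.exp (-(C * L)) *
      Real.exp (-(D * ((F ^ n) b - (F ^ n) a))) * (y - x)) Filter.atTop
      (nhds (Real.exp (-(C * L)) * Real.exp (-(D * 0)) * (y - x))) := by
    refine Filter.Tendsto.mul_const _ (Filter.Tendsto.const_mul _ ?_)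
    exact (Real.continuous_exp.tendsto _).comp ((hlim.const_mul _).neg)
  simpa using le_of_tendsto' hlim2 key

/-- **Kopell's lemma**, for an interval whose forward iterates under `F` have finite total
length. -/
theorem apply_le_of_wandering {F K : Equiv.Perm ℝ} (hF : StrictMono F) (hK : StrictMono K)
    (hFK : Commute F K) {a b : ℝ} (ha : K a = a) (hb : K b = b) {U : Set ℝ}
    (hU : ∀ i : ℕ, Set.Ioo ((F ^ i) a) ((F ^ i) b) ⊆ U) (hFU : LogLipOn F U)
    (hKU : ∀ m : ℕ, LogLipOn ⇑(K ^ m) U) {L : ℝ}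
    (hL : ∀ n : ℕ, ∑ i ∈ Finset.range n, ((F ^ i) b - (F ^ i) a) ≤ L)
    {x : ℝ} (hax : a < x) (hxb : x < b) : K x ≤ x := by
  by_contra! hx
  obtain ⟨C, hC⟩ := hFU.2
  have hpos : 0 < Real.exp (-(C * L)) * (K x - x) :=
    mul_pos (Real.exp_pos _) (sub_pos.mpr hx)
  -- The successive orbit gaps of x all exceed one positive constant, yet they fit inside (x,b).
  have hstep : ∀ m : ℕ, Real.exp (-(C * L)) * (K x - x) ≤ (K ^ (m + 1)) x - (K ^ m) x := by
    intro m
    rw [pow_succ, Equiv.Perm.mul_apply]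
    exact sub_le_sub_of_wandering hF (hK.perm_pow m) (hFK.pow_right m)
      (Equiv.Perm.pow_apply_of_apply_eq ha m) (Equiv.Perm.pow_apply_of_apply_eq hb m) hU hFU
      (hKU m) hC hL hax hx (hb ▸ hK hxb)
  have hsum : ∀ m : ℕ, m * (Real.exp (-(C * L)) * (K x - x)) ≤ (K ^ m) x - x := by
    intro m
    induction m with
    | zero => simp
    | succ m ih =>
      rw [Nat.cast_succ, add_mul, one_mul]
      linarith [hstep m]
  obtain ⟨m, hm⟩ := exists_nat_gt ((b - x) / (Real.exp (-(C * L)) * (K x - x)))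
  rw [div_lt_iff₀ hpos] at hm
  have hlt := hK.perm_pow m hxb
  rw [Equiv.Perm.pow_apply_of_apply_eq hb m] at hlt
  linarith [hsum m]

theorem apply_eq_of_wandering {𝒢 : Subgroup (Equiv.Perm ℝ)} (hmono : ∀ h ∈ 𝒢, StrictMono h)
    {F K : Equiv.Perm ℝ} (hF : F ∈ 𝒢) (hK : K ∈ 𝒢)
    (hFK : Commute F K) {a b : ℝ} (ha : K a = a) (hb : K b = b) {U : Set ℝ}
    (hU : ∀ i : ℕ, Set.Ioo ((F ^ i) a) ((F ^ i) b) ⊆ U) (hlog : ∀ h ∈ 𝒢, LogLipOn h U) {L : ℝ}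
    (hL : ∀ n : ℕ, ∑ i ∈ Finset.range n, ((F ^ i) b - (F ^ i) a) ≤ L)
    {x : ℝ} (hax : a < x) (hxb : x < b) : K x = x := by
  refine le_antisymm ?_ ?_
  · exact apply_le_of_wandering (hmono F hF) (hmono K hK) hFK ha hb hU (hlog F hF)
      (fun m => hlog _ (pow_mem hK m)) hL hax hxb
  · have h := apply_le_of_wandering (hmono F hF) (hmono K hK).perm_inv hFK.inv_right
      (Equiv.Perm.inv_eq_iff_eq.mpr ha.symm) (Equiv.Perm.inv_eq_iff_eq.mpr hb.symm) hU (hlog F hF)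
      (fun m => hlog _ (pow_mem (inv_mem hK) m)) hL hax hxb
    simpa using (hmono K hK).monotone h

/-! ### Commutator identities and monotone orbits -/

theorem pow_mul_eq_of_mul_eq {G : Type*} [Group G] {f g k : G} (h : f * g = k * g * f)
    (hfk : Commute f k) (m : ℕ) : f ^ m * g = k ^ m * g * f ^ m := by
  induction m with
  | zero => simp
  | succ m ih =>
    calc f ^ (m + 1) * g = f ^ m * (f * g) := by rw [pow_succ, mul_assoc]
      _ = (f ^ m * k) * g * f := by rw [h]; simp only [mul_assoc]
      _ = k * (f ^ m * g) * f := by rw [(hfk.pow_left m).eq]; simp only [mul_assoc]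
      _ = k ^ (m + 1) * g * f ^ (m + 1) := by
        rw [ih, pow_succ' k, pow_succ f]; simp only [mul_assoc]

theorem mul_pow_eq_of_mul_eq {G : Type*} [Group G] {f g k : G} (h : f * g = k * g * f)
    (hgk : Commute g k) (m : ℕ) : f * g ^ m = k ^ m * g ^ m * f := by
  rw [← hgk.symm.mul_pow]
  exact SemiconjBy.pow_right h m

theorem inv_mul_eq_of_mul_eq {G : Type*} [Group G] {f g k : G} (h : f * g = k * g * f)
    (hfk : Commute f k) : f⁻¹ * g = k⁻¹ * g * f⁻¹ := by
  rw [eq_mul_inv_iff_mul_eq, eq_inv_mul_iff_mul_eq, ← mul_assoc, ← mul_assoc,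
    ← hfk.inv_left.eq, mul_assoc, mul_assoc, ← mul_assoc k, ← h, inv_mul_cancel_left]

theorem apply_lt_self_of_apply_ne_self {φ : ℝ → ℝ} (hφ : Continuous φ) {a b x : ℝ}
    (hne : ∀ y ∈ Set.Ioo a b, φ y ≠ y) (hx : x ∈ Set.Ioo a b) (hlt : φ x < x) :
    ∀ y ∈ Set.Ioo a b, φ y < y := by
  intro y hy
  by_contra! hcon
  obtain ⟨z, hz, hz'⟩ := isPreconnected_Ioo.intermediate_value₂ hx hy hφ.continuousOn
    continuousOn_id hlt.le hcon
  exact hne z hz hz'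

theorem self_lt_apply_of_apply_ne_self {φ : ℝ → ℝ} (hφ : Continuous φ) {a b x : ℝ}
    (hne : ∀ y ∈ Set.Ioo a b, φ y ≠ y) (hx : x ∈ Set.Ioo a b) (hlt : x < φ x) :
    ∀ y ∈ Set.Ioo a b, y < φ y := by
  intro y hy
  by_contra! hcon
  obtain ⟨z, hz, hz'⟩ := isPreconnected_Ioo.intermediate_value₂ hy hx hφ.continuousOn
    continuousOn_id hcon hlt.le
  exact hne z hz hz'

/-- A decreasing orbit staying above x would converge to a fixed point of K inside (a,b). -/
theorem exists_pow_apply_le {K : Equiv.Perm ℝ} (hK : StrictMono K) {a b : ℝ}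
    (hlt : ∀ x ∈ Set.Ioo a b, K x < x) {p x : ℝ} (hp : p ∈ Set.Ioo a b) (hx : x ∈ Set.Ioo a b) :
    ∃ n : ℕ, (K ^ n) p ≤ x := by
  by_contra! hcon
  have hmem : ∀ n : ℕ, (K ^ n) p ∈ Set.Ioo a b := by
    intro n
    induction n with
    | zero => exact hp
    | succ n ih =>
      refine ⟨hx.1.trans (hcon _), ?_⟩
      rw [pow_succ', Equiv.Perm.mul_apply]
      exact (hlt _ ih).trans ih.2
  have hanti : Antitone fun n : ℕ => (K ^ n) p := by
    refine antitone_nat_of_succ_le fun n => ?_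
    rw [pow_succ', Equiv.Perm.mul_apply]
    exact (hlt _ (hmem n)).le
  have hbdd : BddBelow (Set.range fun n : ℕ => (K ^ n) p) :=
    ⟨x, Set.forall_mem_range.mpr fun n => (hcon n).le⟩
  have hlim := tendsto_atTop_ciInf hanti hbdd
  set l := ⨅ n : ℕ, (K ^ n) p
  have hl : l ∈ Set.Ioo a b :=
    ⟨hx.1.trans_le (le_ciInf fun n => (hcon n).le), (ciInf_le hbdd 0).trans_lt hp.2⟩
  have h1 := (hK.perm_continuous.tendsto l).comp hlim
  have h2 : Filter.Tendsto (fun n : ℕ => K ((K ^ n) p)) Filter.atTop (nhds l) := by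
    refine (hlim.comp (Filter.tendsto_add_atTop_nat 1)).congr fun n => ?_
    simp only [Function.comp_apply]
    rw [pow_succ', Equiv.Perm.mul_apply]
  exact (hlt l hl).ne (tendsto_nhds_unique h1 h2)

/-- Since F^{i+1} b ≤ F^i a, the intervals are lined up leftwards without overlap and the lengths
telescope. -/
theorem sum_sub_pow_le {F : Equiv.Perm ℝ} (hF : StrictMono F) {a b l : ℝ} (h : F b ≤ a)
    (hl : ∀ n : ℕ, l ≤ (F ^ n) b) (n : ℕ) :
    ∑ i ∈ Finset.range n, ((F ^ i) b - (F ^ i) a) ≤ b - l := by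
  refine le_trans ?_ (sub_le_sub_left (hl n) b)
  induction n with
  | zero => simp
  | succ n ih =>
    have h1 : (F ^ (n + 1)) b ≤ (F ^ n) a := by
      rw [pow_succ, Equiv.Perm.mul_apply]
      exact (hF.perm_pow n).monotone h
    rw [Finset.sum_range_succ]
    linarith

theorem pow_apply_le_self {F : Equiv.Perm ℝ} (hF : StrictMono F) {b : ℝ} (h : F b ≤ b) (n : ℕ) :
    (F ^ n) b ≤ b := by
  induction n with
  | zero => exact le_rfl
  | succ n ih =>
    rw [pow_succ, Equiv.Perm.mul_apply]
    exact ((hF.perm_pow n).monotone h).trans ih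

theorem apply_mem_Ioo {f : Equiv.Perm ℝ} (hf : StrictMono f) {a b x : ℝ} (ha : f a = a)
    (hb : f b = b) (hx : x ∈ Set.Ioo a b) : f x ∈ Set.Ioo a b :=
  ⟨ha ▸ hf hx.1, hb ▸ hf hx.2⟩

/-! ### Central commutators fixing the endpoints of an interval -/

/-- **Kopell's lemma** on a half-open interval. -/
theorem apply_eq_of_commute_of_lt {𝒢 : Subgroup (Equiv.Perm ℝ)} (hmono : ∀ h ∈ 𝒢, StrictMono h)
    {g K : Equiv.Perm ℝ} (hg : g ∈ 𝒢) (hK : K ∈ 𝒢) (hgK : Commute g K) {a b : ℝ}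
    (ha : K a = a) (hb : K b = b) (hlt : ∀ x ∈ Set.Ioo a b, K x < x)
    (hlog : ∀ c ∈ Set.Ioo a b, ∀ h ∈ 𝒢, LogLipOn h (Set.Ioo a c))
    {p x : ℝ} (hp : p ∈ Set.Ioo a b) (hgp : g p = p) (hx : x ∈ Set.Ioo a b) : g x = x := by
  have hKm := hmono K hK
  -- K⁻¹ carries fixed points of g to fixed points of g and pushes them towards b, past x.
  obtain ⟨q, hq, hgq, hxq⟩ : ∃ q ∈ Set.Ioo a b, g q = q ∧ x < q := by
    obtain ⟨y, hxy, hyb⟩ := exists_between hx.2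
    obtain ⟨n, hn⟩ := exists_pow_apply_le hKm hlt ⟨hx.1.trans hxy, hyb⟩ hp
    have hKn := (hKm.perm_pow n).perm_inv
    refine ⟨(K ^ n)⁻¹ p, apply_mem_Ioo hKn ?_ ?_ hp, ?_, ?_⟩
    · exact Equiv.Perm.inv_eq_iff_eq.mpr (Equiv.Perm.pow_apply_of_apply_eq ha n).symm
    · exact Equiv.Perm.inv_eq_iff_eq.mpr (Equiv.Perm.pow_apply_of_apply_eq hb n).symm
    · rw [((hgK.pow_right n).inv_right).perm_apply, hgp]
    · refine hxy.trans_le ?_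
      simpa using hKn.monotone hn
  have hex := exists_pow_apply_le hKm hlt hq hx
  classical
  have hmin := fun m => Nat.find_min hex (m := m)
  have hspec := Nat.find_spec hex
  set n := Nat.find hex
  obtain ⟨m, hm⟩ : ∃ m, n = m + 1 :=
    Nat.exists_eq_succ_of_ne_zero fun h0 => hxq.not_ge (by simpa [h0] using hspec)
  have hmx : x < (K ^ m) q := not_le.mp (hmin m (by omega))
  have hfix : ∀ i : ℕ, g ((K ^ i) q) = (K ^ i) q := fun i => by
    rw [(hgK.pow_right i).perm_apply, hgq]
  have hmem : ∀ i : ℕ, (K ^ i) q ∈ Set.Ioo a b := fun i =>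
    apply_mem_Ioo (hKm.perm_pow i) (Equiv.Perm.pow_apply_of_apply_eq ha i)
      (Equiv.Perm.pow_apply_of_apply_eq hb i) hq
  rw [hm] at hspec
  rcases hspec.eq_or_lt with heq | hlt'
  · rw [← heq, hfix]
  have hstep : K ((K ^ m) q) = (K ^ (m + 1)) q := by rw [pow_succ', Equiv.Perm.mul_apply]
  have hmem' : ∀ i j : ℕ, (K ^ i) ((K ^ j) q) ∈ Set.Ioo a b := fun i j => by
    rw [← Equiv.Perm.mul_apply, ← pow_add]
    exact hmem _
  -- The roles are exchanged: K is the wandering map, with fundamental domain from K^{m+1} q to K^m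
  -- q, and g is the map shown to be trivial. U stays away from b, where smoothness may fail.
  refine apply_eq_of_wandering (U := Set.Ioo a ((K ^ m) q)) (L := (K ^ m) q - a) hmono hK hg
    hgK.symm (hfix (m + 1)) (hfix m) ?_ (hlog _ (hmem m))
    (sum_sub_pow_le hKm hstep.le fun i => (hmem' i m).1.le) hlt' hmx
  intro i y hy
  exact ⟨(hmem' i (m + 1)).1.trans hy.1,
    hy.2.trans_le (pow_apply_le_self hKm (hlt _ (hmem m)).le i)⟩

theorem false_of_central_commutator_of_lt {𝒢 : Subgroup (Equiv.Perm ℝ)}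
    (hmono : ∀ h ∈ 𝒢, StrictMono h) {f g K : Equiv.Perm ℝ} (hf : StrictMono f) (hg : g ∈ 𝒢)
    (hK : K ∈ 𝒢) (hfg : f * g = K * g * f) (hfK : Commute f K) (hgK : Commute g K)
    {a b : ℝ} (hab : a < b) (hfa : f a = a) (hfb : f b = b) (hga : g a = a) (hgb : g b = b)
    (hKa : K a = a) (hKb : K b = b) (hlt : ∀ x ∈ Set.Ioo a b, K x < x)
    (hlog : ∀ c ∈ Set.Ioo a b, ∀ h ∈ 𝒢, LogLipOn h (Set.Ioo a c)) : False := by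
  have hKm := hmono K hK
  obtain ⟨x, hx⟩ : (Set.Ioo a b).Nonempty := Set.nonempty_Ioo.mpr hab
  obtain ⟨n, hn⟩ := exists_pow_apply_le hKm hlt hx (apply_mem_Ioo (hmono g hg) hga hgb hx)
  have hn1 : (K ^ (n + 1)) x < g x := by
    refine lt_of_lt_of_le ?_ hn
    rw [pow_succ, Equiv.Perm.mul_apply]
    exact hKm.perm_pow n (hlt x hx)
  -- The exponent n + 1 makes K^{n+1} x < g x strict, so h moves x up; h still satisfies the
  -- commutator relation with f.
  set h : Equiv.Perm ℝ := (K ^ (n + 1))⁻¹ * g with hh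
  have hh𝒢 : h ∈ 𝒢 := mul_mem (inv_mem (pow_mem hK _)) hg
  have hhK : Commute h K :=
    ((Commute.refl K).pow_left (n + 1)).inv_left.mul_left hgK
  have hxh : x < h x := by
    have h1 := (hKm.perm_pow (n + 1)).perm_inv hn1
    rwa [show (K ^ (n + 1))⁻¹ ((K ^ (n + 1)) x) = x from (K ^ (n + 1)).symm_apply_apply x] at h1
  have hpos : ∀ y ∈ Set.Ioo a b, y < h y := by
    refine self_lt_apply_of_apply_ne_self (hmono h hh𝒢).perm_continuous ?_ hx hxh
    intro p hp hhp
    exact hxh.ne' (apply_eq_of_commute_of_lt hmono hh𝒢 hK hhK hKa hKb hlt hlog hp hhp hx)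
  have hfh : f * h = K * h * f := by
    have hc := (hfK.pow_right (n + 1)).inv_right
    have hc' := ((Commute.refl K).pow_right (n + 1)).inv_right
    calc f * h = (f * (K ^ (n + 1))⁻¹) * g := by rw [hh, mul_assoc]
      _ = (K ^ (n + 1))⁻¹ * (f * g) := by rw [hc.eq, mul_assoc]
      _ = ((K ^ (n + 1))⁻¹ * K) * g * f := by rw [hfg]; simp only [mul_assoc]
      _ = K * h * f := by rw [← hc'.eq, hh]; simp only [mul_assoc]
  have hha : h a = a := by
    rw [hh, Equiv.Perm.mul_apply, hga]
    exact Equiv.Perm.inv_eq_iff_eq.mpr (Equiv.Perm.pow_apply_of_apply_eq hKa _).symm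
  have hhb : h b = b := by
    rw [hh, Equiv.Perm.mul_apply, hgb]
    exact Equiv.Perm.inv_eq_iff_eq.mpr (Equiv.Perm.pow_apply_of_apply_eq hKb _).symm
  -- K^m h sends x to a point ≤ x, although it is conjugate by f^m to h, which moves all of (a,b)
  -- up.
  obtain ⟨m, hm⟩ := exists_pow_apply_le hKm hlt (apply_mem_Ioo (hmono h hh𝒢) hha hhb hx) hx
  have hfm := hf.perm_pow m
  have hy : (f ^ m)⁻¹ x ∈ Set.Ioo a b := by
    refine apply_mem_Ioo hfm.perm_inv ?_ ?_ hx
    · exact Equiv.Perm.inv_eq_iff_eq.mpr (Equiv.Perm.pow_apply_of_apply_eq hfa _).symm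
    · exact Equiv.Perm.inv_eq_iff_eq.mpr (Equiv.Perm.pow_apply_of_apply_eq hfb _).symm
  have h1 := hfm (hpos _ hy)
  have h2 := DFunLike.congr_fun (pow_mul_eq_of_mul_eq hfh hfK m) ((f ^ m)⁻¹ x)
  simp only [Equiv.Perm.mul_apply] at h2
  rw [h2] at h1
  rw [show (f ^ m) ((f ^ m)⁻¹ x) = x from (f ^ m).apply_symm_apply x] at h1
  exact h1.not_ge hm

/-- A central commutator `K` of two maps which fix the endpoints of an interval has a fixed point
inside that interval. -/
theorem false_of_central_commutator {𝒢 : Subgroup (Equiv.Perm ℝ)}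
    (hmono : ∀ h ∈ 𝒢, StrictMono h) {f g K : Equiv.Perm ℝ} (hf : StrictMono f) (hg : g ∈ 𝒢)
    (hK : K ∈ 𝒢) (hfg : f * g = K * g * f) (hfK : Commute f K) (hgK : Commute g K)
    {a b : ℝ} (hab : a < b) (hfa : f a = a) (hfb : f b = b) (hga : g a = a) (hgb : g b = b)
    (hKa : K a = a) (hKb : K b = b) (hne : ∀ x ∈ Set.Ioo a b, K x ≠ x)
    (hlog : ∀ c ∈ Set.Ioo a b, ∀ h ∈ 𝒢, LogLipOn h (Set.Ioo a c)) : False := by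
  have hKm := hmono K hK
  obtain ⟨x, hx⟩ : (Set.Ioo a b).Nonempty := Set.nonempty_Ioo.mpr hab
  rcases (hne x hx).lt_or_gt with hlt | hgt
  · exact false_of_central_commutator_of_lt hmono hf hg hK hfg hfK hgK hab hfa hfb hga hgb hKa hKb
      (apply_lt_self_of_apply_ne_self hKm.perm_continuous hne hx hlt) hlog
  -- Replacing f by f⁻¹ replaces the commutator K by K⁻¹, which moves points down.
  · refine false_of_central_commutator_of_lt hmono hf.perm_inv hg (inv_mem hK)
      (inv_mul_eq_of_mul_eq hfg hfK) hfK.inv_inv hgK.inv_right hab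
      (Equiv.Perm.inv_eq_iff_eq.mpr hfa.symm) (Equiv.Perm.inv_eq_iff_eq.mpr hfb.symm) hga hgb
      (Equiv.Perm.inv_eq_iff_eq.mpr hKa.symm) (Equiv.Perm.inv_eq_iff_eq.mpr hKb.symm) ?_ hlog
    intro y hy
    have h1 := hKm.perm_inv
      (self_lt_apply_of_apply_ne_self hKm.perm_continuous hne hx hgt y hy)
    simpa using h1

/-! ### Components of the complement of the fixed point set -/

theorem exists_component_of_apply_ne {K : ℝ → ℝ} (hK : Continuous K) {x l r : ℝ} (hx : K x ≠ x)
    (hl : K l = l) (hlx : l ≤ x) (hr : K r = r) (hxr : x ≤ r) :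
    ∃ a b, l ≤ a ∧ a < x ∧ x < b ∧ b ≤ r ∧ K a = a ∧ K b = b ∧
      ∀ y ∈ Set.Ioo a b, K y ≠ y := by
  have hclosed : IsClosed {y | K y = y} := isClosed_eq hK continuous_id
  have hA : IsCompact ({y | K y = y} ∩ Set.Icc l x) := isCompact_Icc.inter_left hclosed
  have hB : IsCompact ({y | K y = y} ∩ Set.Icc x r) := isCompact_Icc.inter_left hclosed
  obtain ⟨a, ⟨ha, hla, hax⟩, hamax⟩ := hA.exists_isGreatest ⟨l, hl, le_rfl, hlx⟩
  obtain ⟨b, ⟨hb, hxb, hbr⟩, hbmin⟩ := hB.exists_isLeast ⟨r, hr, hxr, le_rfl⟩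
  refine ⟨a, b, hla, lt_of_le_of_ne hax fun h => hx (h ▸ ha),
    lt_of_le_of_ne hxb fun h => hx (h ▸ hb), hbr, ha, hb, ?_⟩
  intro y hy hKy
  rcases le_total y x with h | h
  · exact (hamax ⟨hKy, hla.trans hy.1.le, h⟩).not_gt hy.1
  · exact (hbmin ⟨hKy, h, hy.2.le.trans hbr⟩).not_gt hy.2

/-- Otherwise F⁻¹ a would be a fixed point of K inside (a,b). -/
theorem apply_right_le_left_of_apply_left_lt {F K : Equiv.Perm ℝ} (hF : StrictMono F)
    (hFK : Commute F K) {a b : ℝ} (ha : K a = a)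
    (hne : ∀ x ∈ Set.Ioo a b, K x ≠ x) (h : F a < a) : F b ≤ a := by
  by_contra! hcon
  refine hne (F⁻¹ a) ⟨?_, ?_⟩ (hFK.inv_left.perm_apply_fixed ha)
  · simpa using hF.perm_inv h
  · simpa using hF.perm_inv hcon

theorem apply_right_eq_of_apply_left_eq {F K : Equiv.Perm ℝ} (hF : StrictMono F)
    (hFK : Commute F K) {a b : ℝ} (hab : a < b) (hb : K b = b)
    (hne : ∀ x ∈ Set.Ioo a b, K x ≠ x) (h : F a = a) : F b = b := by
  rcases lt_trichotomy (F b) b with hlt | heq | hgt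
  · exact (hne (F b) ⟨h ▸ hF hab, hlt⟩ (hFK.perm_apply_fixed hb)).elim
  · exact heq
  · refine (hne (F⁻¹ b) ⟨?_, ?_⟩ (hFK.inv_left.perm_apply_fixed hb)).elim
    · have h1 := hF.perm_inv hab
      rwa [Equiv.Perm.inv_eq_iff_eq.mpr h.symm] at h1
    · simpa using hF.perm_inv hgt

/-! ### From C² regularity to Lipschitz log-derivatives -/

theorem derivWithin_pos_of_leftInverse {J : Set ℝ} (hJ : UniqueDiffOn ℝ J) {h k : ℝ → ℝ}
    (hh : DifferentiableOn ℝ h J) (hk : DifferentiableOn ℝ k J) (hmaps : Set.MapsTo h J J)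
    (hinv : ∀ x ∈ J, k (h x) = x) (hmono : MonotoneOn h J) {x : ℝ} (hx : x ∈ J) :
    0 < derivWithin h J x := by
  refine lt_of_le_of_ne hmono.derivWithin_nonneg fun h0 => ?_
  have h1 := (hk (h x) (hmaps hx)).hasDerivWithinAt.comp x (hh x hx).hasDerivWithinAt hmaps
  rw [← h0, mul_zero] at h1
  have h2 : HasDerivWithinAt (k ∘ h) 1 J x :=
    (hasDerivWithinAt_id x J).congr (fun y hy => hinv y hy) (hinv x hx)
  exact zero_ne_one ((hJ x hx).eq_deriv _ h1 h2)

theorem contDiffOn_log_derivWithin {J : Set ℝ} (hJ : UniqueDiffOn ℝ J) {h k : ℝ → ℝ}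
    (hh : ContDiffOn ℝ 2 h J) (hk : ContDiffOn ℝ 2 k J) (hmaps : Set.MapsTo h J J)
    (hinv : ∀ x ∈ J, k (h x) = x) (hmono : MonotoneOn h J) :
    ContDiffOn ℝ 1 (fun x => Real.log (derivWithin h J x)) J :=
  ContDiffOn.log (hh.derivWithin hJ (by norm_num)) fun _ hx =>
    (derivWithin_pos_of_leftInverse hJ (hh.differentiableOn (by norm_num))
      (hk.differentiableOn (by norm_num)) hmaps hinv hmono hx).ne'

theorem logLipOn_Ioo_of_contDiffOn {J : Set ℝ} (hJ : UniqueDiffOn ℝ J) {h k : ℝ → ℝ}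
    (hh : ContDiffOn ℝ 2 h J) (hk : ContDiffOn ℝ 2 k J) (hmaps : Set.MapsTo h J J)
    (hinv : ∀ x ∈ J, k (h x) = x) (hmono : MonotoneOn h J) {p q : ℝ} (hpq : Set.Icc p q ⊆ J) :
    LogLipOn h (Set.Ioo p q) := by
  have hnhds : ∀ x ∈ Set.Ioo p q, J ∈ nhds x := fun x hx =>
    Filter.mem_of_superset (Icc_mem_nhds hx.1 hx.2) hpq
  have hderiv : ∀ x ∈ Set.Ioo p q, derivWithin h J x = deriv h x := fun x hx =>
    derivWithin_of_mem_nhds (hnhds x hx)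
  refine ⟨fun x hx => ⟨?_, ?_⟩, ?_⟩
  · exact (hh.differentiableOn (by norm_num)).differentiableAt (hnhds x hx)
  · rw [← hderiv x hx]
    exact derivWithin_pos_of_leftInverse hJ (hh.differentiableOn (by norm_num))
      (hk.differentiableOn (by norm_num)) hmaps hinv hmono (mem_of_mem_nhds (hnhds x hx))
  · obtain ⟨C, hC⟩ := ((contDiffOn_log_derivWithin hJ hh hk hmaps hinv hmono).mono
      hpq).exists_lipschitzOnWith (by norm_num) (convex_Icc p q) isCompact_Icc
    refine ⟨C, fun x hx y hy => ?_⟩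
    simpa only [hderiv x hx, hderiv y hy] using
      hC (Set.Ioo_subset_Icc_self hx) (Set.Ioo_subset_Icc_self hy)

/-! ### The interval case -/

/-- Plante-Thurston for a group of homeomorphisms of the line which is supported in `[0, 1]` and
sufficiently smooth on `[0, 1)`. -/
theorem eq_one_of_central_commutator_of_supported {𝒢 : Subgroup (Equiv.Perm ℝ)}
    (hmono : ∀ h ∈ 𝒢, StrictMono h) (hleft : ∀ h ∈ 𝒢, ∀ x ≤ 0, h x = x)
    (hright : ∀ h ∈ 𝒢, ∀ x : ℝ, 1 ≤ x → h x = x)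
    (hlog : ∀ c < (1 : ℝ), ∀ h ∈ 𝒢, LogLipOn h (Set.Ioo 0 c))
    {f g K : Equiv.Perm ℝ} (hf : f ∈ 𝒢) (hg : g ∈ 𝒢) (hK : K ∈ 𝒢) (hfg : f * g = K * g * f)
    (hfK : Commute f K) (hgK : Commute g K) : K = 1 := by
  by_contra hK1
  obtain ⟨x, hx⟩ : ∃ x, K x ≠ x := by
    by_contra! hcon
    exact hK1 (Equiv.ext hcon)
  have hx0 : 0 ≤ x := not_lt.mp fun h => hx (hleft K hK x h.le)
  have hx1 : x ≤ 1 := not_lt.mp fun h => hx (hright K hK x h.le)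
  obtain ⟨a, b, h0a, hax, hxb, hb1, hKa, hKb, hne⟩ :=
    exists_component_of_apply_ne (hmono K hK).perm_continuous hx (hleft K hK 0 le_rfl) hx0
      (hright K hK 1 le_rfl) hx1
  have hxab : x ∈ Set.Ioo a b := ⟨hax, hxb⟩
  -- If F a < a, the component (a,b) wanders to the left and Kopell makes K trivial on it. Here b <
  -- 1 because F fixes 1, so all iterates stay in the region of controlled derivatives.
  have key : ∀ F ∈ 𝒢, Commute F K → ¬ F a < a := by
    intro F hF hFK hlt
    have hba := apply_right_le_left_of_apply_left_lt (hmono F hF) hFK hKa hne hlt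
    have hb : b < 1 := by
      refine lt_of_le_of_ne hb1 fun h => ?_
      rw [hright F hF b h.ge] at hba
      exact hba.not_gt (hax.trans hxb)
    have hnonneg : ∀ n : ℕ, ∀ y, 0 ≤ y → 0 ≤ (F ^ n) y := fun n y hy => by
      have h1 := (hmono _ (pow_mem hF n)).monotone hy
      rwa [hleft _ (pow_mem hF n) 0 le_rfl] at h1
    refine hx (apply_eq_of_wandering (U := Set.Ioo 0 b) hmono hF hK hFK hKa hKb ?_ (hlog b hb)
      (sum_sub_pow_le (hmono F hF) hba
        fun n => hnonneg n b (h0a.trans (hax.trans hxb).le)) hax hxb)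
    intro i y hy
    exact ⟨(hnonneg i a h0a).trans_lt hy.1, hy.2.trans_le
      (pow_apply_le_self (hmono F hF) (hba.trans (hax.trans hxb).le) i)⟩
  have hfix : ∀ F ∈ 𝒢, Commute F K → F a = a := by
    intro F hF hFK
    refine le_antisymm (not_lt.mp fun h => ?_) (not_lt.mp (key F hF hFK))
    refine key F⁻¹ (inv_mem hF) hFK.inv_left ?_
    simpa using (hmono F hF).perm_inv h
  have hfix' : ∀ F ∈ 𝒢, Commute F K → F b = b := fun F hF hFK =>
    apply_right_eq_of_apply_left_eq (hmono F hF) hFK (hax.trans hxb) hKb hne (hfix F hF hFK)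
  exact false_of_central_commutator hmono (hmono f hf) hg hK hfg hfK hgK (hax.trans hxb)
    (hfix f hf hfK) (hfix' f hf hfK) (hfix g hg hgK) (hfix' g hg hgK) hKa hKb hne
    fun c hc h hh => (hlog c (hc.2.trans_le hb1) h hh).mono (Set.Ioo_subset_Ioo_left h0a)

open Classical in
/-- Extension of a bijection of `J` to the real line by the identity. -/
noncomputable def extendPerm (J : Set ℝ) : Equiv.Perm J →* Equiv.Perm ℝ :=
  Equiv.Perm.ofSubtype

open Classical in
theorem extendPerm_apply_coe {J : Set ℝ} (f : Equiv.Perm J) (x : J) : extendPerm J f x = f x :=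
  Equiv.Perm.ofSubtype_apply_coe f x

open Classical in
theorem extendPerm_apply_of_notMem {J : Set ℝ} (f : Equiv.Perm J) {x : ℝ} (hx : x ∉ J) :
    extendPerm J f x = x :=
  Equiv.Perm.ofSubtype_apply_of_not_mem f hx

open Classical in
theorem extendPerm_injective (J : Set ℝ) : Function.Injective (extendPerm J) :=
  Equiv.Perm.ofSubtype_injective

theorem strictMono_extendPerm {J : Set ℝ} (hJ : J.OrdConnected) {f : Equiv.Perm J}
    (hf : StrictMono f) : StrictMono (extendPerm J f) := by
  intro x y hxy
  by_cases hx : x ∈ J <;> by_cases hy : y ∈ J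
  · lift x to J using hx
    lift y to J using hy
    rw [extendPerm_apply_coe, extendPerm_apply_coe]
    exact hf hxy
  · lift x to J using hx
    rw [extendPerm_apply_coe, extendPerm_apply_of_notMem f hy]
    by_contra! hcon
    exact hy (hJ.out x.2 (f x).2 ⟨hxy.le, hcon⟩)
  · lift y to J using hy
    rw [extendPerm_apply_coe, extendPerm_apply_of_notMem f hx]
    by_contra! hcon
    exact hx (hJ.out (f y).2 y.2 ⟨hcon, hxy.le⟩)
  · rwa [extendPerm_apply_of_notMem f hx, extendPerm_apply_of_notMem f hy]

theorem IsCTwoOn.contDiffOn_extendPerm {J : Set ℝ} {f : Equiv.Perm J} (hf : IsCTwoOn J f) :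
    ContDiffOn ℝ 2 (extendPerm J f) J := by
  obtain ⟨F, hF, hFf⟩ := hf
  refine hF.congr fun x hx => ?_
  lift x to J using hx
  rw [extendPerm_apply_coe, hFf]

theorem diffTwoInterval_eq_one_of_central_commutator {J : Set ℝ} (hJ : J.OrdConnected)
    (hJ1 : J ⊆ Set.Icc 0 1) (hJ2 : Set.Ico 0 1 ⊆ J) {f g K : Equiv.Perm J}
    (hf : f ∈ diffTwoInterval J) (hg : g ∈ diffTwoInterval J) (hK : K ∈ diffTwoInterval J)
    (hfg : f * g = K * g * f) (hfK : Commute f K) (hgK : Commute g K) : K = 1 := by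
  have hmono : ∀ h ∈ (diffTwoInterval J).map (extendPerm J), StrictMono h := by
    rintro _ ⟨h, hh, rfl⟩
    exact strictMono_extendPerm hJ hh.2.2
  have hclosed : ∀ h ∈ (diffTwoInterval J).map (extendPerm J), IsClosed {x | h x = x} :=
    fun h hh => isClosed_eq (hmono h hh).perm_continuous continuous_id
  have hout : ∀ h ∈ (diffTwoInterval J).map (extendPerm J), ∀ x ∉ J, h x = x := by
    rintro _ ⟨h, hh, rfl⟩ x hx
    exact extendPerm_apply_of_notMem h hx
  have hJdiff : UniqueDiffOn ℝ J := by
    refine uniqueDiffOn_convex hJ.convex ?_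
    refine ((Set.nonempty_Ioo.mpr (zero_lt_one' ℝ)).mono ?_ : (interior J).Nonempty)
    exact interior_maximal (Set.Ioo_subset_Ico_self.trans hJ2) isOpen_Ioo
  apply extendPerm_injective J
  rw [map_one]
  refine eq_one_of_central_commutator_of_supported (𝒢 := (diffTwoInterval J).map (extendPerm J))
    hmono ?_ ?_ ?_ (Subgroup.mem_map_of_mem _ hf) (Subgroup.mem_map_of_mem _ hg)
    (Subgroup.mem_map_of_mem _ hK) ?_ (hfK.map _) (hgK.map _)
  · intro h hh x hx
    -- The endpoint 0 belongs to J, so it is reached by continuity from outside J.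
    have hsub : Set.Iio (0 : ℝ) ⊆ {x | h x = x} := fun y hy =>
      hout h hh y fun hyJ => (hJ1 hyJ).1.not_gt hy
    exact closure_minimal hsub (hclosed h hh) (by rwa [closure_Iio, Set.mem_Iic])
  · intro h hh x hx
    have hsub : Set.Ioi (1 : ℝ) ⊆ {x | h x = x} := fun y hy =>
      hout h hh y fun hyJ => (hJ1 hyJ).2.not_gt hy
    exact closure_minimal hsub (hclosed h hh) (by rwa [closure_Ioi, Set.mem_Ici])
  · rintro c hc _ ⟨h, hh, rfl⟩
    refine logLipOn_Ioo_of_contDiffOn (k := extendPerm J h⁻¹) hJdiff hh.1.contDiffOn_extendPerm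
      (IsCTwoOn.contDiffOn_extendPerm hh.2.1) ?_ ?_
      ((strictMono_extendPerm hJ hh.2.2).monotone.monotoneOn J)
      fun x hx => hJ2 ⟨hx.1, hx.2.trans_lt hc⟩
    · intro x hx
      lift x to J using hx
      rw [extendPerm_apply_coe]
      exact (h x).2
    · intro x _
      rw [map_inv]
      exact (extendPerm J h).symm_apply_apply x
  · rw [← map_mul, hfg, map_mul, map_mul]

/-! ### Dynamics of lifts of circle maps -/

theorem mul_left_eq_of_central {G : Type*} [Group G] {f g k c : G} (h : f * g = k * g * f)
    (hcg : Commute c g) (hck : Commute c k) : c * f * g = k * g * (c * f) := by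
  rw [mul_assoc, h, ← mul_assoc, (hck.mul_right hcg).eq, mul_assoc]

theorem mul_right_eq_of_central {G : Type*} [Group G] {f g k c : G} (h : f * g = k * g * f)
    (hcf : Commute c f) (hck : Commute c k) : f * (c * g) = k * (c * g) * f := by
  rw [← mul_assoc, ← hcf.eq, mul_assoc, h, ← mul_assoc, ← mul_assoc, hck.eq, ← mul_assoc]

/-- A monotone map of the line has no periodic points other than fixed points. -/
theorem pow_apply_ne_self {K : Equiv.Perm ℝ} (hK : StrictMono K) {x : ℝ} (hx : K x ≠ x) {n : ℕ}
    (hn : 0 < n) : (K ^ n) x ≠ x := by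
  intro h
  refine hx (((Function.Commute.id_right (f := K)).iterate_pos_eq_iff_map_eq hK.monotone
    strictMono_id hn).mp ?_)
  rwa [Function.iterate_id, Equiv.Perm.iterate_eq_pow]

/-- A permutation of the line which commutes with the unit translation, as a lift of a degree one
map of the circle. -/
def Equiv.Perm.toDegOneLift (F : Equiv.Perm ℝ) (hF : StrictMono F)
    (hF1 : ∀ x, F (x + 1) = F x + 1) : CircleDeg1Lift :=
  ⟨⟨F, hF.monotone⟩, hF1⟩

/-- The translation of the line by an integer. -/
def intTranslation (n : ℤ) : Equiv.Perm ℝ := Equiv.addRight (n : ℝ)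

theorem intTranslation_apply (n : ℤ) (x : ℝ) : intTranslation n x = x + n := rfl

theorem apply_add_int {F : Equiv.Perm ℝ} (hF : StrictMono F) (hF1 : ∀ x, F (x + 1) = F x + 1)
    (x : ℝ) (n : ℤ) : F (x + n) = F x + n :=
  (F.toDegOneLift hF hF1).map_add_int x n

theorem commute_intTranslation {F : Equiv.Perm ℝ} (hF : StrictMono F)
    (hF1 : ∀ x, F (x + 1) = F x + 1) (n : ℤ) : Commute (intTranslation n) F :=
  Equiv.ext fun x => (apply_add_int hF hF1 x n).symm

theorem pairwise_disjoint_sum_le {a : ℝ} {A B : ℕ → ℝ} (hA : ∀ i, a ≤ A i) (hAB : ∀ i, A i ≤ B i)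
    (hB : ∀ i, B i ≤ a + 1) (hd : Pairwise (Function.onFun Disjoint fun i => Set.Ioo (A i) (B i)))
    (n : ℕ) : ∑ i ∈ Finset.range n, (B i - A i) ≤ 1 := by
  have h1 : MeasureTheory.volume (⋃ i ∈ Finset.range n, Set.Ioo (A i) (B i)) ≤
      MeasureTheory.volume (Set.Icc a (a + 1)) := by
    refine MeasureTheory.measure_mono (Set.iUnion₂_subset fun i _ x hx => ?_)
    exact ⟨(hA i).trans hx.1.le, hx.2.le.trans (hB i)⟩
  rw [MeasureTheory.measure_biUnion_finset (fun i _ j _ hij => hd hij)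
    (fun i _ => measurableSet_Ioo)] at h1
  simp only [Real.volume_Ioo, Real.volume_Icc, add_sub_cancel_left] at h1
  rw [← ENNReal.ofReal_sum_of_nonneg fun i _ => sub_nonneg.mpr (hAB i)] at h1
  exact (ENNReal.ofReal_le_ofReal_iff zero_le_one).mp h1

theorem disjoint_Ioo_of_apply_ne {K : ℝ → ℝ} {a b a' b' : ℝ} (ha : K a = a) (ha' : K a' = a')
    (hne : ∀ x ∈ Set.Ioo a b, K x ≠ x) (hne' : ∀ x ∈ Set.Ioo a' b', K x ≠ x) (h : a ≠ a') :
    Disjoint (Set.Ioo a b) (Set.Ioo a' b') := by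
  rw [Set.disjoint_left]
  intro x hx hx'
  rcases h.lt_or_gt with h | h
  · exact hne a' ⟨h, hx'.1.trans hx.2⟩ ha'
  · exact hne' a ⟨h, hx.1.trans hx'.2⟩ ha

theorem apply_ne_of_commute {F K : Equiv.Perm ℝ} (hF : StrictMono F) (hFK : Commute F K)
    {a b : ℝ} (hne : ∀ x ∈ Set.Ioo a b, K x ≠ x) : ∀ x ∈ Set.Ioo (F a) (F b), K x ≠ x := by
  intro x hx hKx
  refine hne (F⁻¹ x) ⟨?_, ?_⟩ (hFK.inv_left.perm_apply_fixed hKx)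
  · simpa using hF.perm_inv hx.1
  · simpa using hF.perm_inv hx.2

/-- Some iterate of `F` maps a component of the complement of the fixed point set of `K` to one of
its integer translates. -/
theorem exists_pow_apply_add_int_eq {𝒢 : Subgroup (Equiv.Perm ℝ)}
    (hmono : ∀ h ∈ 𝒢, StrictMono h) (hper : ∀ h ∈ 𝒢, ∀ x, h (x + 1) = h x + 1)
    (hlog : ∀ h ∈ 𝒢, LogLipOn h Set.univ) {F K : Equiv.Perm ℝ} (hF : F ∈ 𝒢) (hK : K ∈ 𝒢)
    (hFK : Commute F K) {a b : ℝ} (hab : a < b) (hKa : K a = a) (hKb : K b = b)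
    (hne : ∀ x ∈ Set.Ioo a b, K x ≠ x) :
    ∃ n : ℕ, 0 < n ∧ ∃ p : ℤ, (F ^ n) a + p = a := by
  by_contra! hcon
  -- Translate F^i(a,b) so that its left end lies in [a, a+1). If no iterate returns to a modulo
  -- integers, these are distinct components inside [a, a+1], so their total length is at most 1.
  set φ : ℕ → Equiv.Perm ℝ := fun i => intTranslation (-⌊(F ^ i) a - a⌋) * F ^ i with hφ
  have hφapply : ∀ i x, φ i x = (F ^ i) x - ⌊(F ^ i) a - a⌋ := fun i x => by
    rw [hφ, Equiv.Perm.mul_apply, intTranslation_apply, Int.cast_neg]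
    exact (sub_eq_add_neg _ _).symm
  have hφmono : ∀ i, StrictMono (φ i) := fun i x y hxy => by
    rw [hφapply, hφapply]
    exact sub_lt_sub_right (hmono _ (pow_mem hF i) hxy) _
  have hφK : ∀ i, Commute (φ i) K := fun i =>
    (commute_intTranslation (hmono K hK) (hper K hK) _).mul_left (hFK.pow_left i)
  have hφne := fun i => apply_ne_of_commute (hφmono i) (hφK i) hne
  have hφa := fun i => (hφK i).perm_apply_fixed hKa
  have hφinj : ∀ i j, i < j → φ i a ≠ φ j a := by
    intro i j hij heq
    rw [hφapply, hφapply] at heq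
    obtain ⟨d, rfl⟩ := Nat.exists_eq_add_of_lt hij
    refine hcon (d + 1) d.succ_pos (⌊(F ^ i) a - a⌋ - ⌊(F ^ (i + d + 1)) a - a⌋) ?_
    apply (F ^ i).injective
    rw [apply_add_int (hmono _ (pow_mem hF i)) (hper _ (pow_mem hF i)), ← Equiv.Perm.mul_apply,
      ← pow_add, ← add_assoc, Int.cast_sub]
    linarith
  have hsum := pairwise_disjoint_sum_le (a := a) (A := fun i => φ i a) (B := fun i => φ i b)
    (fun i => by
      rw [hφapply]
      linarith [Int.floor_le ((F ^ i) a - a)])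
    (fun i => (hφmono i hab).le)
    (fun i => by
      by_contra! h
      -- The fixed point a + 1 of K cannot lie inside a component.
      refine hφne i (a + 1) ⟨?_, h⟩ (by rw [hper K hK, hKa])
      rw [hφapply]
      linarith [Int.lt_floor_add_one ((F ^ i) a - a)])
    (fun i j hij => disjoint_Ioo_of_apply_ne (hφa i) (hφa j) (hφne i) (hφne j)
      (hij.lt_or_gt.elim (hφinj i j) fun h => (hφinj j i h).symm))
  obtain ⟨x, hax, hxb⟩ := exists_between hab
  refine hne x ⟨hax, hxb⟩ (apply_eq_of_wandering (L := 1) hmono hF hK hFK hKa hKb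
    (fun _ => Set.subset_univ _) hlog (fun n => ?_) hax hxb)
  refine le_trans (le_of_eq (Finset.sum_congr rfl fun i _ => ?_)) (hsum n)
  simp only [hφapply]
  ring

/-- Plante-Thurston for a group of smooth lifts of circle maps, when the commutator has a fixed
point. -/
theorem eq_one_of_central_commutator_of_periodic {𝒢 : Subgroup (Equiv.Perm ℝ)}
    (hmono : ∀ h ∈ 𝒢, StrictMono h) (hper : ∀ h ∈ 𝒢, ∀ x, h (x + 1) = h x + 1)
    (htrans : ∀ n, intTranslation n ∈ 𝒢) (hlog : ∀ h ∈ 𝒢, LogLipOn h Set.univ)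
    {f g K : Equiv.Perm ℝ} (hf : f ∈ 𝒢) (hg : g ∈ 𝒢) (hK : K ∈ 𝒢) (hfg : f * g = K * g * f)
    (hfK : Commute f K) (hgK : Commute g K) {p : ℝ} (hp : K p = p) : K = 1 := by
  by_contra hK1
  obtain ⟨x, hx⟩ : ∃ x, K x ≠ x := by
    by_contra! hcon
    exact hK1 (Equiv.ext hcon)
  have hcentral : ∀ n, ∀ h ∈ 𝒢, Commute (intTranslation n) h := fun n h hh =>
    commute_intTranslation (hmono h hh) (hper h hh) n
  have hl : K (p + ⌊x - p⌋) = p + ⌊x - p⌋ := by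
    rw [apply_add_int (hmono K hK) (hper K hK), hp]
  obtain ⟨a, b, -, hax, hxb, -, hKa, hKb, hne⟩ :=
    exists_component_of_apply_ne (hmono K hK).perm_continuous hx hl
      (by linarith [Int.floor_le (x - p)])
      (by rw [hper K hK, hl] : K (p + ⌊x - p⌋ + 1) = p + ⌊x - p⌋ + 1)
      (by linarith [Int.lt_floor_add_one (x - p)])
  have hab := hax.trans hxb
  obtain ⟨n, hn, r, hr⟩ := exists_pow_apply_add_int_eq hmono hper hlog hf hK hfK hab hKa hKb hne
  obtain ⟨m, hm, s, hs⟩ := exists_pow_apply_add_int_eq hmono hper hlog hg hK hgK hab hKa hKb hne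
  set f' := intTranslation r * f ^ n
  set g' := intTranslation s * g ^ m
  -- Integer translations are central, so the commutator of f' and g' is that of f^n and g^m, namely
  -- K^{nm}.
  set K' := (K ^ n) ^ m
  have hf' : f' ∈ 𝒢 := mul_mem (htrans r) (pow_mem hf n)
  have hg' : g' ∈ 𝒢 := mul_mem (htrans s) (pow_mem hg m)
  have hK' : K' ∈ 𝒢 := pow_mem (pow_mem hK n) m
  have hfg' : f' * g' = K' * g' * f' :=
    mul_left_eq_of_central (mul_right_eq_of_central
      (mul_pow_eq_of_mul_eq (pow_mul_eq_of_mul_eq hfg hfK n) (hgK.pow_right n) m)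
      (hcentral s _ (pow_mem hf n)) (hcentral s _ hK')) (hcentral r _ hg') (hcentral r _ hK')
  have hfK1 : Commute f' K := (hcentral r K hK).mul_left (hfK.pow_left n)
  have hgK1 : Commute g' K := (hcentral s K hK).mul_left (hgK.pow_left m)
  have hfa : f' a = a := hr
  have hga : g' a = a := hs
  have hne' : ∀ y ∈ Set.Ioo a b, K' y ≠ y := fun y hy =>
    pow_apply_ne_self (hmono _ (pow_mem hK n)) (pow_apply_ne_self (hmono K hK) (hne y hy) hn) hm
  refine false_of_central_commutator hmono (hmono f' hf') hg' hK' hfg'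
    ((hfK1.pow_right n).pow_right m) ((hgK1.pow_right n).pow_right m) hab hfa
    (apply_right_eq_of_apply_left_eq (hmono f' hf') hfK1 hab hKb hne hfa) hga
    (apply_right_eq_of_apply_left_eq (hmono g' hg') hgK1 hab hKb hne hga) ?_ ?_ hne'
    fun c _ h hh => (hlog h hh).mono (Set.subset_univ _)
  · exact Equiv.Perm.pow_apply_of_apply_eq (Equiv.Perm.pow_apply_of_apply_eq hKa n) m
  · exact Equiv.Perm.pow_apply_of_apply_eq (Equiv.Perm.pow_apply_of_apply_eq hKb n) m

/-! ### Translation numbers -/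

/-- Degree one lifts which commute up to an integer translation commute exactly. -/
theorem commute_of_commute_up_to_translation {f K : Equiv.Perm ℝ} (hf : StrictMono f)
    (hf1 : ∀ x, f (x + 1) = f x + 1) (hK : StrictMono K) (hK1 : ∀ x, K (x + 1) = K x + 1) {n : ℤ}
    (h : f * K = intTranslation n * K * f) : Commute f K := by
  have hs : SemiconjBy (f.toDegOneLift hf hf1) (K.toDegOneLift hK hK1)
      (↑(CircleDeg1Lift.translate (Multiplicative.ofAdd (n : ℝ))) * K.toDegOneLift hK hK1) := by
    ext x
    have hx := DFunLike.congr_fun h x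
    simp only [Equiv.Perm.mul_apply, intTranslation_apply] at hx
    simp only [CircleDeg1Lift.mul_apply, CircleDeg1Lift.translate_apply]
    exact hx.trans (add_comm _ _)
  have hc : Commute (↑(CircleDeg1Lift.translate (Multiplicative.ofAdd (n : ℝ))) : CircleDeg1Lift)
      (K.toDegOneLift hK hK1) := by
    ext x
    simp only [CircleDeg1Lift.mul_apply, CircleDeg1Lift.translate_apply,
      CircleDeg1Lift.map_int_add]
  -- Conjugate lifts have equal translation numbers, so τ(K) = n + τ(K) and n = 0.
  have hτ := CircleDeg1Lift.translationNumber_eq_of_semiconjBy hs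
  rw [CircleDeg1Lift.translationNumber_mul_of_commute hc,
    CircleDeg1Lift.translationNumber_translate, right_eq_add, Int.cast_eq_zero] at hτ
  ext x
  have hx := DFunLike.congr_fun h x
  simpa [hτ, intTranslation_apply] using hx

/-- Since g is conjugate to Kg and K commutes with g, τ(g) = τ(K) + τ(g). Thus τ(K) = 0, which for a
continuous lift gives a fixed point. -/
theorem exists_fixed_of_commutator {f g K : Equiv.Perm ℝ} (hf : StrictMono f)
    (hf1 : ∀ x, f (x + 1) = f x + 1) (hg : StrictMono g) (hg1 : ∀ x, g (x + 1) = g x + 1)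
    (hK : StrictMono K) (hK1 : ∀ x, K (x + 1) = K x + 1) (hfg : f * g = K * g * f)
    (hgK : Commute g K) : ∃ x, K x = x := by
  have hs : SemiconjBy (f.toDegOneLift hf hf1) (g.toDegOneLift hg hg1)
      (K.toDegOneLift hK hK1 * g.toDegOneLift hg hg1) :=
    CircleDeg1Lift.ext fun x => DFunLike.congr_fun hfg x
  have hc : Commute (K.toDegOneLift hK hK1) (g.toDegOneLift hg hg1) :=
    CircleDeg1Lift.ext fun x => DFunLike.congr_fun hgK.symm.eq x
  have hτ := CircleDeg1Lift.translationNumber_eq_of_semiconjBy hs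
  rw [CircleDeg1Lift.translationNumber_mul_of_commute hc, right_eq_add] at hτ
  obtain ⟨x, hx⟩ := (K.toDegOneLift hK hK1).exists_eq_add_translationNumber hK.perm_continuous
  rw [hτ, add_zero] at hx
  exact ⟨x, hx⟩

/-! ### Lifting circle diffeomorphisms -/

/-- The universal covering of the circle, with period one. -/
noncomputable def unitCover (t : ℝ) : Circle := Circle.exp (2 * Real.pi * t)

theorem unitCover_eq_iff {s t : ℝ} : unitCover s = unitCover t ↔ ∃ n : ℤ, s = t + n := by
  rw [unitCover, unitCover, Circle.exp_eq_exp]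
  refine exists_congr fun n => ?_
  rw [show 2 * Real.pi * t + n * (2 * Real.pi) = 2 * Real.pi * (t + n) by ring]
  exact mul_right_inj' Real.two_pi_pos.ne'

theorem unitCover_add_int (t : ℝ) (n : ℤ) : unitCover (t + n) = unitCover t :=
  unitCover_eq_iff.mpr ⟨n, rfl⟩

theorem unitCover_surjective : Function.Surjective unitCover := by
  intro z
  refine ⟨Complex.arg z / (2 * Real.pi), ?_⟩
  rw [unitCover, mul_div_cancel₀ _ Real.two_pi_pos.ne', Circle.exp_arg]

/-- The increasing lifts to the line of the elements of `diffTwoCircle`. -/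
def diffTwoCircleLifts : Subgroup (Equiv.Perm ℝ) where
  carrier := {F | StrictMono F ∧ ∃ f ∈ diffTwoCircle, ∀ t, f (unitCover t) = unitCover (F t)}
  mul_mem' := by
    rintro F G ⟨hF, f, hf, hfF⟩ ⟨hG, g, hg, hgG⟩
    refine ⟨hF.perm_mul hG, f * g, mul_mem hf hg, fun t => ?_⟩
    rw [Equiv.Perm.mul_apply, hgG, hfF, Equiv.Perm.mul_apply]
  one_mem' := ⟨strictMono_id, 1, one_mem _, fun _ => rfl⟩
  inv_mem' := by
    rintro F ⟨hF, f, hf, hfF⟩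
    refine ⟨hF.perm_inv, f⁻¹, inv_mem hf, fun t => ?_⟩
    rw [Equiv.Perm.inv_eq_iff_eq, hfF]
    exact congrArg unitCover (F.apply_symm_apply t).symm

theorem intTranslation_mem_diffTwoCircleLifts (n : ℤ) : intTranslation n ∈ diffTwoCircleLifts :=
  ⟨fun _ _ h => add_lt_add_left h _, 1, one_mem _, fun t => (unitCover_add_int t n).symm⟩

theorem exists_lift_of_mem_diffTwoCircle {f : Equiv.Perm Circle} (hf : f ∈ diffTwoCircle) :
    ∃ F ∈ diffTwoCircleLifts, ∀ t, f (unitCover t) = unitCover (F t) := by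
  obtain ⟨F, hF⟩ := hf.2.2
  let m : Equiv.Perm ℝ := Equiv.mulLeft₀ (2 * Real.pi) Real.two_pi_pos.ne'
  have hm : StrictMono m := fun x y h => mul_lt_mul_of_pos_left h Real.two_pi_pos
  have hlift : ∀ t, f (unitCover t) = unitCover ((m⁻¹ * F.toEquiv * m) t) := by
    intro t
    rw [unitCover, hF]
    exact congrArg Circle.exp (m.apply_symm_apply _).symm
  exact ⟨m⁻¹ * F.toEquiv * m, ⟨(hm.perm_inv.comp F.strictMono).comp hm, f, hf, hlift⟩, hlift⟩

theorem lift_add_one {F : Equiv.Perm ℝ} (hF : StrictMono F) {f : Equiv.Perm Circle}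
    (hfF : ∀ t, f (unitCover t) = unitCover (F t)) (t : ℝ) : F (t + 1) = F t + 1 := by
  have h1 : unitCover (F (t + 1)) = unitCover (F t) := by
    rw [← hfF, ← hfF]
    exact congrArg f (by simpa using unitCover_add_int t 1)
  obtain ⟨n, hn⟩ := unitCover_eq_iff.mp h1
  have hn0 : 0 < n := by
    have h2 := hF (lt_add_one t)
    rw [hn] at h2
    exact_mod_cast (lt_add_iff_pos_right _).mp h2
  -- If n > 1, the preimage of F t + 1 lies strictly between t and t + 1, and injectivity of f puts
  -- it over the same point of the circle as t.
  have hn2 : ¬ 1 < n := by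
    intro h
    have h' : (1 : ℝ) < n := by exact_mod_cast h
    have hs : F (F⁻¹ (F t + 1)) = F t + 1 := F.apply_symm_apply _
    have h3 : t < F⁻¹ (F t + 1) := hF.lt_iff_lt.mp (by rw [hs]; linarith)
    have h4 : F⁻¹ (F t + 1) < t + 1 := hF.lt_iff_lt.mp (by rw [hs]; linarith)
    have h5 : unitCover (F⁻¹ (F t + 1)) = unitCover t := by
      apply f.injective
      rw [hfF, hfF, hs]
      simpa using unitCover_add_int (F t) 1
    obtain ⟨k, hk⟩ := unitCover_eq_iff.mp h5
    rw [hk] at h3 h4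
    have h6 : (0 : ℝ) < k := by linarith
    have h7 : (k : ℝ) < 1 := by linarith
    norm_cast at h6 h7
    omega
  have hn1 : n = 1 := by omega
  rw [hn, hn1, Int.cast_one]

theorem eq_intTranslation_of_unitCover_eq {Q : Equiv.Perm ℝ} (hQ : StrictMono Q)
    (h : ∀ t, unitCover (Q t) = unitCover t) : ∃ n : ℤ, Q = intTranslation n := by
  have hper : ∀ t, Q (t + 1) = Q t + 1 :=
    lift_add_one hQ (f := 1) fun t => (h t).symm
  choose n hn using fun t => unitCover_eq_iff.mp (h t)
  refine ⟨n 0, Equiv.ext fun t => ?_⟩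
  have h1 : Q (Int.fract t) = Int.fract t + n 0 := by
    rcases (Int.fract_nonneg t).eq_or_lt with h0 | h0
    · rw [← h0, hn 0]
    · have h2 := hQ h0
      have h3 := hQ (Int.fract_lt_one t)
      rw [← zero_add (1 : ℝ), hper, hn 0, hn] at h3
      rw [hn 0, hn] at h2
      have h4 := Int.fract_lt_one t
      have h5 : (n 0 : ℝ) < n (Int.fract t) + 1 := by linarith
      have h6 : (n (Int.fract t) : ℝ) < n 0 + 1 := by linarith
      norm_cast at h5 h6
      rw [hn, show n (Int.fract t) = n 0 by omega]
  rw [intTranslation_apply, ← Int.fract_add_floor t, apply_add_int hQ hper, h1]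
  ring

/-- Near t₀ the lift is recovered from f by the principal logarithm of E t / E t₀, a value near 1;
|F t - F t₀| < 1/2 keeps the angle in (-π, π). -/
theorem contDiff_lift {F : ℝ → ℝ} (hF : Continuous F) {f : Circle → Circle}
    (hf : ContMDiff (𝓡 1) (𝓡 1) 2 f) (hfF : ∀ t, f (unitCover t) = unitCover (F t)) :
    ContDiff ℝ 2 F := by
  have hE : ContDiff ℝ 2 fun t : ℝ => (f (unitCover t) : ℂ) := by
    have : Fact (Module.finrank ℝ ℂ = 1 + 1) := Complex.finrank_real_complex_fact
    have h1 : ContMDiff 𝓘(ℝ, ℝ) (𝓡 1) 2 unitCover :=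
      contMDiff_circleExp.comp ((contDiff_const.mul contDiff_id).contMDiff)
    have h2 : ContMDiff (𝓡 1) 𝓘(ℝ, ℂ) 2 (fun z : Circle => (z : ℂ)) := contMDiff_coe_sphere
    exact (h2.comp (hf.comp h1)).contDiff
  rw [contDiff_iff_contDiffAt]
  intro t₀
  set E : ℝ → ℂ := fun t => (f (unitCover t) : ℂ)
  have hEexp : ∀ t, E t / E t₀ = Complex.exp ((2 * Real.pi * (F t - F t₀) : ℝ) * Complex.I) := by
    intro t
    have h1 : ∀ s, E s = Complex.exp ((2 * Real.pi * F s : ℝ) * Complex.I) := fun s =>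
      (congrArg (fun z : Circle => (z : ℂ)) (hfF s)).trans (Circle.coe_exp _)
    rw [h1, h1, ← Complex.exp_sub]
    push_cast
    ring_nf
  have hsmooth : ContDiffAt ℝ 2 (fun t => (Complex.log (E t / E t₀)).im) t₀ := by
    have h0 : E t₀ / E t₀ = 1 := by
      rw [hEexp]
      simp
    have hlog : ContDiffAt ℝ 2 Complex.log (E t₀ / E t₀) := by
      rw [h0]
      exact (Complex.contDiffAt_log Complex.one_mem_slitPlane).restrict_scalars ℝ
    exact Complex.imCLM.contDiff.contDiffAt.comp t₀
      (hlog.comp t₀ (hE.contDiffAt.div_const _))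
  have hev : ∀ᶠ t in nhds t₀, F t = F t₀ + (Complex.log (E t / E t₀)).im / (2 * Real.pi) := by
    have h1 : ∀ᶠ t in nhds t₀, |F t - F t₀| < 1 / 2 := by
      have h2 : Filter.Tendsto (fun t => |F t - F t₀|) (nhds t₀) (nhds |F t₀ - F t₀|) :=
        (by fun_prop : Continuous fun t => |F t - F t₀|).tendsto t₀
      exact h2.eventually_lt_const (by norm_num)
    filter_upwards [h1] with t ht
    rw [abs_lt] at ht
    have hpi := Real.pi_pos
    rw [hEexp, Complex.log_exp]
    · simp only [Complex.mul_im, Complex.ofReal_re, Complex.ofReal_im, Complex.I_re, Complex.I_im]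
      field_simp
      ring
    · simp only [Complex.mul_im, Complex.ofReal_re, Complex.ofReal_im, Complex.I_re, Complex.I_im]
      nlinarith [ht.1]
    · simp only [Complex.mul_im, Complex.ofReal_re, Complex.ofReal_im, Complex.I_re, Complex.I_im]
      nlinarith [ht.2]
  exact (contDiffAt_const.add (hsmooth.div_const _)).congr_of_eventuallyEq hev

theorem Function.Periodic.deriv {φ : ℝ → ℝ} {c : ℝ} (h : Function.Periodic φ c) :
    Function.Periodic (deriv φ) c := by
  intro x
  rw [← deriv_comp_add_const, funext h]

/-- The derivative of log h' is continuous and periodic, hence bounded on the whole line. -/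
theorem logLipOn_univ_of_contDiff {h k : ℝ → ℝ} (hh : ContDiff ℝ 2 h) (hk : ContDiff ℝ 2 k)
    (hinv : ∀ x, k (h x) = x) (hmono : Monotone h) (hper : ∀ x, h (x + 1) = h x + 1) :
    LogLipOn h Set.univ := by
  have hmaps := Set.mapsTo_univ h Set.univ
  refine ⟨fun x _ => ⟨hh.differentiable (by norm_num) x, ?_⟩, ?_⟩
  · rw [← derivWithin_univ]
    exact derivWithin_pos_of_leftInverse uniqueDiffOn_univ
      (hh.differentiable (by norm_num)).differentiableOn
      (hk.differentiable (by norm_num)).differentiableOn hmaps (fun x _ => hinv x)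
      (hmono.monotoneOn _) (Set.mem_univ x)
  · have hlog := contDiffOn_log_derivWithin uniqueDiffOn_univ hh.contDiffOn hk.contDiffOn hmaps
      (fun x _ => hinv x) (hmono.monotoneOn _)
    rw [derivWithin_univ, contDiffOn_univ] at hlog
    have hp1 : Function.Periodic (deriv h) 1 := by
      intro x
      rw [← deriv_comp_add_const, funext hper, deriv_add_const]
    have hp2 : Function.Periodic (fun x => Real.log (deriv h x)) 1 := fun x =>
      congrArg Real.log (hp1 x)
    obtain ⟨C, hC⟩ := (hp2.deriv.isBounded_of_continuous one_ne_zero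
      (hlog.continuous_deriv le_rfl)).exists_norm_le
    refine ⟨C.toNNReal, (lipschitzWith_of_nnnorm_deriv_le
      (hlog.differentiable one_ne_zero) fun x => ?_).lipschitzOnWith⟩
    rw [← norm_toNNReal]
    exact Real.toNNReal_le_toNNReal (hC _ ⟨x, rfl⟩)

theorem contDiff_of_mem_diffTwoCircleLifts {F : Equiv.Perm ℝ} (hF : F ∈ diffTwoCircleLifts) :
    ContDiff ℝ 2 F := by
  obtain ⟨hmono, f, hf, hfF⟩ := hF
  exact contDiff_lift hmono.perm_continuous hf.1 hfF

theorem diffTwoCircle_eq_one_of_central_commutator {f g k : Equiv.Perm Circle}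
    (hf : f ∈ diffTwoCircle) (hg : g ∈ diffTwoCircle) (hfg : f * g = k * g * f)
    (hfk : Commute f k) (hgk : Commute g k) : k = 1 := by
  obtain ⟨F, hF, hfF⟩ := exists_lift_of_mem_diffTwoCircle hf
  obtain ⟨G, hG, hgG⟩ := exists_lift_of_mem_diffTwoCircle hg
  have hmono : ∀ h ∈ diffTwoCircleLifts, StrictMono h := fun h hh => hh.1
  have hper : ∀ h ∈ diffTwoCircleLifts, ∀ x, h (x + 1) = h x + 1 := by
    rintro h ⟨hh, f, -, hfh⟩
    exact lift_add_one hh hfh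
  have hlog : ∀ h ∈ diffTwoCircleLifts, LogLipOn h Set.univ := fun h hh =>
    logLipOn_univ_of_contDiff (contDiff_of_mem_diffTwoCircleLifts hh)
      (contDiff_of_mem_diffTwoCircleLifts (inv_mem hh)) (fun x => h.symm_apply_apply x)
      (hmono h hh).monotone (hper h hh)
  set K : Equiv.Perm ℝ := F * G * F⁻¹ * G⁻¹ with hKdef
  have hK : K ∈ diffTwoCircleLifts := mul_mem (mul_mem (mul_mem hF hG) (inv_mem hF)) (inv_mem hG)
  have hFG : F * G = K * G * F := by
    rw [hKdef]
    group
  have hkK : ∀ t, k (unitCover t) = unitCover (K t) := by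
    intro t
    obtain ⟨s, rfl⟩ := (G * F).surjective t
    have h1 := DFunLike.congr_fun hfg (unitCover s)
    have h2 := DFunLike.congr_fun hFG s
    simp only [Equiv.Perm.mul_apply, hfF, hgG] at h1 h2 ⊢
    rw [← h1, h2]
  -- Commutation on the circle lifts only up to an integer translation, which translation numbers
  -- then force to be trivial.
  have hcomm : ∀ H ∈ diffTwoCircleLifts, ∀ h : Equiv.Perm Circle, Commute h k →
      (∀ t, h (unitCover t) = unitCover (H t)) → Commute H K := by
    intro H hH h hhk hhH
    obtain ⟨n, hn⟩ := eq_intTranslation_of_unitCover_eq (Q := H * K * (K * H)⁻¹)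
      (hmono _ (mul_mem (mul_mem hH hK) (inv_mem (mul_mem hK hH)))) (by
        intro t
        obtain ⟨s, rfl⟩ := (K * H).surjective t
        have h1 := DFunLike.congr_fun hhk.eq (unitCover s)
        simp only [Equiv.Perm.mul_apply, hhH, hkK] at h1
        rw [Equiv.Perm.mul_apply,
          show (K * H)⁻¹ ((K * H) s) = s from (K * H).symm_apply_apply s]
        exact h1)
    refine commute_of_commute_up_to_translation (hmono H hH) (hper H hH) (hmono K hK)
      (hper K hK) (n := n) ?_
    rw [← hn]
    group
  have hFK := hcomm F hF f hfk hfF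
  have hGK := hcomm G hG g hgk hgG
  obtain ⟨p, hp⟩ := exists_fixed_of_commutator (hmono F hF) (hper F hF) (hmono G hG) (hper G hG)
    (hmono K hK) (hper K hK) hFG hGK
  have hK1 := eq_one_of_central_commutator_of_periodic hmono hper
    intTranslation_mem_diffTwoCircleLifts hlog hF hG hK hFG hFK hGK hp
  ext z
  obtain ⟨t, rfl⟩ := unitCover_surjective z
  rw [hkK, hK1]
  rfl

/-! ### Conclusion -/

/-- A nilpotent group of permutations is abelian if central commutators are trivial in the
ambient group. -/
theorem mul_comm_of_isNilpotent_of_central_commutator {α : Type*} {D : Subgroup (Equiv.Perm α)}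
    (hD : ∀ f ∈ D, ∀ g ∈ D, ∀ k ∈ D, f * g = k * g * f → Commute f k → Commute g k → k = 1)
    (N : Subgroup D) (hN : Group.IsNilpotent N) (f : D) (hf : f ∈ N) (g : D) (hg : g ∈ N) :
    f * g = g * f := by
  refine congrArg Subtype.val (hN.mul_comm_of_central_commutator ?_ ⟨f, hf⟩ ⟨g, hg⟩)
  intro f g k hfg hfk hgk
  let ι : N →* Equiv.Perm α := D.subtype.comp N.subtype
  have hι : Function.Injective ι :=
    (Subgroup.subtype_injective D).comp (Subgroup.subtype_injective N)
  refine hι (hD (ι f) f.1.2 (ι g) g.1.2 (ι k) k.1.2 ?_ (hfk.map ι) (hgk.map ι))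
  rw [← map_mul, hfg, map_mul, map_mul]

theorem mainTheorem2 :
    (∀ N : Subgroup (diffTwoInterval (Set.Icc (0 : ℝ) 1)),
      Group.IsNilpotent N → ∀ f ∈ N, ∀ g ∈ N, f * g = g * f) ∧
    (∀ N : Subgroup (diffTwoInterval (Set.Ico (0 : ℝ) 1)),
      Group.IsNilpotent N → ∀ f ∈ N, ∀ g ∈ N, f * g = g * f) ∧
    (∀ N : Subgroup diffTwoCircle,
      Group.IsNilpotent N → ∀ f ∈ N, ∀ g ∈ N, f * g = g * f) := by
  refine ⟨mul_comm_of_isNilpotent_of_central_commutator ?_,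
    mul_comm_of_isNilpotent_of_central_commutator ?_,
    mul_comm_of_isNilpotent_of_central_commutator ?_⟩
  · intro f hf g hg k hk
    exact diffTwoInterval_eq_one_of_central_commutator Set.ordConnected_Icc subset_rfl
      Set.Ico_subset_Icc_self hf hg hk
  · intro f hf g hg k hk
    exact diffTwoInterval_eq_one_of_central_commutator Set.ordConnected_Ico
      Set.Ico_subset_Icc_self subset_rfl hf hg hk
  · intro f hf g hg k _
    exact diffTwoCircle_eq_one_of_central_commutator hf hg
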